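/- Let $(\Omega,d)$ be a compact metric space with its Borel $\sigma$-algebra, let $P^\star$ be a Borel probability measure on $\Omega$ whose support is all of $\Omega$, and let $\omega^1,\omega^2,\dots$ be independent observations with law $P^\star$. For $k\ge 0$ let $\Omega^k=\{\omega^1,\dots,\omega^k\}$ be the set of values among the first $k$ observations. Let $\psi_1,\dots,\psi_q:\Omega\to\mathbb R$ be functions and put $\hat b_i^k=\frac1k\sum_{j=1}^k\psi_i(\omega^j)$ for $k\ge1$. Define the approximate moment ambiguity set $$\widehat{\mathfrak P}^k_{\rm mom}=\Big\{p\in\mathbb R_{\ge0}^{\Omega^k}\ :\ \sum_{\omega\in\Omega^k}p(\omega)=1,\ \ \sum_{\omega\in\Omega^k}p(\omega)\psi_i(\omega)=\hat b_i^k\ (i=1,\dots,q)\Big\}$$ (so $\widehat{\mathfrak P}^0_{\rm mom}=\emptyset$). For $\theta^k\in[0,1]$ let $\Theta^k:\mathbb R^{\Omega^{k-1}}\to\mathbb R^{\Omega^k}$ be the map $$\Theta^k(p)(\omega)=\begin{cases}\theta^k p(\omega)&\omega\in\Omega^{k-1},\ \omega\ne\omega^k,\\ \theta^kp(\omega)+(1-\theta^k)&\omega\in\Omega^{k-1},\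 \omega=\omega^k,\\ 1-\theta^k&\omega\notin\Omega^{k-1},\ \omega=\omega^k.\end{cases}$$ (1) For every $k\ge1$ and every sequence of observations, if $\theta^k=\frac{k-1}{k}$ and $p\in\widehat{\mathfrak P}^{k-1}_{\rm mom}$, then $\Theta^k(p)\in\widehat{\mathfrak P}^{k}_{\rm mom}$. (2) Suppose moreover that $\psi_1,\dots,\psi_q$ are continuous. Let $b_i=\int_\Omega\psi_i\,dP^\star$ and let $\mathfrak P_{\rm mom}$ be the set of all Borel probability measures $P$ on $\Omega$ such that $\int_\Omega\psi_i\,dP=b_i$ for $i=1,\dots,q$. Let $\mathcal F$ be an equicontinuous class of functions $\Omega\to\mathbb R$ with $\sup_{F\in\mathcal F}\sup_{\omega,\omega'}|F(\omega)-F(\omega')|<\infty$ (for instance any class of Lipschitz functions with a common Lipschitz constant, so that the bounded Lipschitz, Kantorovich and Fortet–Mourier metrics are included), and for probability measures and sets of probability measures put $$d(P,P')=\sup_{F\in\mathcal F}\Big|\int F\,dP-\int F\,dP'\Big|,\qquad \mathbb H(A,B)=\max\Big\{\sup_{P\in A}\inf_{P'\in B}d(P,P'),\ \sup_{P\in B}\inf_{P'\in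 A}d(P,P')\Big\}.$$ Identify $p\in\widehat{\mathfrak P}^k_{\rm mom}$ with the measure $\sum_{\omega\in\Omega^k}p(\omega)\delta_\omega$ on $\Omega$. Then almost surely the following holds: if $\widehat{\mathfrak P}^k_{\rm mom}\neq\emptyset$ for all $k\ge1$, then $\mathbb H(\widehat{\mathfrak P}^k_{\rm mom},\mathfrak P_{\rm mom})\to0$ as $k\to\infty$. -/

import Mathlib

open MeasureTheory ProbabilityTheory Filter Topology
open scoped ENNReal

noncomputable section

namespace MomentAmbiguity

/-! Distances between (sets of) probability measures -/

section Distance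

variable {Ω : Type*} [MeasurableSpace Ω]

/-- The uniform distance of expectations `d(P, P')` induced by a class `𝓕` of functions,
i.e. the supremum of `|∫ F dP - ∫ F dP'|` over `F ∈ 𝓕`, with values in `[0, ∞]`. -/
def zetaDist (𝓕 : Set (Ω → ℝ)) (P P' : Measure Ω) : ℝ≥0∞ :=
  ⨆ F ∈ 𝓕, ENNReal.ofReal |(∫ ω, F ω ∂P) - ∫ ω, F ω ∂P'|

/-- Distance of a probability measure to a set of probability measures. -/
def distToSet (𝓕 : Set (Ω → ℝ)) (P : Measure Ω) (A : Set (Measure Ω)) : ℝ≥0∞ :=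
  ⨅ P' ∈ A, zetaDist 𝓕 P P'

/-- The deviation `𝔻(A, B)`: the largest distance of an element of `B` to the set `A`. -/
def deviation (𝓕 : Set (Ω → ℝ)) (A B : Set (Measure Ω)) : ℝ≥0∞ :=
  ⨆ P ∈ B, distToSet 𝓕 P A

/-- The Hausdorff distance `ℍ(A, B)` between two sets of probability measures. -/
def hausdorffDistance (𝓕 : Set (Ω → ℝ)) (A B : Set (Measure Ω)) : ℝ≥0∞ :=
  max (deviation 𝓕 A B) (deviation 𝓕 B A)

/-- The moment ambiguity set: all probability measures on `Ω` whose generalized moments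
with respect to `ψ i` exist and are equal to `b i`. -/
def momentSet {q : ℕ} (ψ : Fin q → Ω → ℝ) (b : Fin q → ℝ) : Set (Measure Ω) :=
  {P | IsProbabilityMeasure P ∧ ∀ i, Integrable (ψ i) P ∧ ∫ ω, ψ i ω ∂P = b i}

end Distance

/-! Samples. An infinite sequence of observations `ω¹, ω², …` is a function `x : ℕ → Ω`, where
`x j` is the observation `ω^(j+1)`; the first `k` observations are `x 0, …, x (k - 1)`. -/

section Sample

variable {Ω : Type*}

open Classical in
/-- The set `Ω^k` of (distinct) values among the first `k` observations. -/
def sampleSet (x : ℕ → Ω) (k : ℕ) : Finset Ω :=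
  (Finset.range k).image x

/-- The sample moments `(1/k) ∑_{j ≤ k} ψ i (ω^j)`. -/
def sampleMoment {q : ℕ} (ψ : Fin q → Ω → ℝ) (x : ℕ → Ω) (k : ℕ) (i : Fin q) : ℝ :=
  (1 / (k : ℝ)) * ∑ j ∈ Finset.range k, ψ i (x j)

/-- The approximate moment ambiguity set: all probability vectors `p` on the sample `Ω^k` whose
generalized moments coincide with the sample moments. -/
def approxMomentSet {q : ℕ} (ψ : Fin q → Ω → ℝ) (x : ℕ → Ω) (k : ℕ) :
    Set (sampleSet x k → ℝ) :=
  {p | (∀ ω, 0 ≤ p ω) ∧ ∑ ω, p ω = 1 ∧ ∀ i, ∑ ω, p ω * ψ i ω = sampleMoment ψ x k i}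

open Classical in
/-- The update map from vectors on the first `k` observations to vectors on the first
`k + 1` observations, with parameter `θ`; the new observation `ω^(k+1)` is `x k`.
In the last case `ω` is in `Ω^(k+1)` but not in `Ω^k`, so `ω` is the new observation. -/
def updateMap (x : ℕ → Ω) (k : ℕ) (θ : ℝ) (p : sampleSet x k → ℝ) :
    sampleSet x (k + 1) → ℝ := fun ω =>
  if h : (ω : Ω) ∈ sampleSet x k then
    if (ω : Ω) = x k then θ * p ⟨ω, h⟩ + (1 - θ) else θ * p ⟨ω, h⟩
  else 1 - θ

/-- The discrete measure `∑_{ω ∈ A} p(ω) δ_ω` on `Ω` given by a nonnegative vector `p` on the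
finite set `A`. -/
def discreteMeasure [MeasurableSpace Ω] {A : Finset Ω} (p : A → ℝ) : Measure Ω :=
  ∑ ω : A, ENNReal.ofReal (p ω) • Measure.dirac (ω : Ω)

end Sample

end MomentAmbiguity

end

/-!
For the update map, the new vector is the mixture with weights `k / (k + 1)` and `1 / (k + 1)` of the
old vector and the unit mass at the new observation (`sum_updateMap_mul`), and the sample moments are
updated by the same mixture.

For the convergence, the difficulty is that a probability measure `Q` whose moments are only nearly
right has to be moved to a nearby one with exactly the prescribed moments, without leaving the set of
measures carried by the sample. Let `W` be the finite-dimensional space of continuous functions spanned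
by `1` and the moment functions, and let `E` be a probability measure with the prescribed moments: the
empirical measure for the approximate set, the true distribution `P` for the limit set. Put
`ν = (1 - ε) Q + (ε + h) E` with `h ∈ W` determined by
`∫ h g dE = (1 - ε) (∫ g dE - ∫ g dQ)` for all `g ∈ W`.
Then `ν` has the moments of `E`, it is a probability measure as soon as `|h| ≤ ε`, and a function of
oscillation at most `C` has expectations under `Q` and `ν` that differ by at most `3 ε C`
(`exists_measure_of_density`). In a basis of `W`, the equations for `h` are a linear system with the
Gram matrix of the basis in `L²(E)`. For `E = P` this matrix is invertible since `P` has full support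
(`isUnit_det_gramMatrix`), so by continuity `h` is small whenever `E` is weakly close to `P` and the
moments of `Q` are close to those of `E` (`exists_measure_moments_eq`).

Almost surely, the empirical measures converge weakly to `P`
(`ae_tendsto_integral_empiricalMeasure`). Consequently the moments of the approximate sets converge, and
the sample becomes an `η`-net for every `η > 0` (`eventually_forall_exists_dist_lt`). A measure in the
approximate set can thus be adjusted directly with `E = P`, while a measure in the limit set is first
pushed forward to the sample by a nearest-point map, which changes expectations by a modulus of uniform
equicontinuity, and then adjusted with the empirical measure as `E`. All bounds are uniform over
the sets, so both deviations tend to zero.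
-/

noncomputable section

namespace MomentAmbiguity

/-! ### Adjusting the moments of a measure -/

section Adjust

/-- If `G` is invertible, then the systems `A a = v` with `A` near `G` and `v` near `0` have
solutions `a` near `0`; Cramer's rule makes the solution a continuous function of `(A, v)`. -/
theorem exists_mulVec_eq_and_norm_lt {Ω ι : Type*} [TopologicalSpace Ω] [CompactSpace Ω]
    [Fintype ι] [DecidableEq ι] (f : ι → C(Ω, ℝ)) (G : ι → ι → ℝ) (hG : IsUnit (Matrix.of G).det)
    {ε : ℝ} (hε : 0 < ε) :
    ∃ δ > 0, ∀ (A : ι → ι → ℝ) (v : ι → ℝ), (∀ i j, |A i j - G i j| < δ) → (∀ i, |v i| < δ) →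
      ∃ a : ι → ℝ, (Matrix.of A).mulVec a = v ∧ ‖∑ i, a i • f i‖ < ε := by
  have hdet : Continuous fun p : (ι → ι → ℝ) × (ι → ℝ) => (Matrix.of p.1).det :=
    Continuous.matrix_det (by exact continuous_fst)
  have hadj : Continuous fun p : (ι → ι → ℝ) × (ι → ℝ) =>
      (Matrix.of p.1).adjugate.mulVec p.2 :=
    (Continuous.matrix_adjugate (by exact continuous_fst)).matrix_mulVec continuous_snd
  have hcont : ContinuousAt (fun p : (ι → ι → ℝ) × (ι → ℝ) =>
      ‖∑ i, ((Matrix.of p.1).det⁻¹ * (Matrix.of p.1).adjugate.mulVec p.2 i) • f i‖) (G, 0) := by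
    refine (tendsto_finsetSum _ fun i _ => Tendsto.smul_const ?_ _).norm
    exact (hdet.continuousAt.inv₀ hG.ne_zero).mul ((continuous_apply i).comp hadj).continuousAt
  have hev := ((tendsto_order.1 hcont).2 ε (by simpa using hε)).and
    (hdet.continuousAt.eventually_ne hG.ne_zero)
  obtain ⟨δ, hδ, hball⟩ := Metric.eventually_nhds_iff.1 hev
  refine ⟨δ, hδ, fun A v hA hv => ?_⟩
  have hd : dist (A, v) (G, (0 : ι → ℝ)) < δ := by
    rw [Prod.dist_eq, max_lt_iff, dist_pi_lt_iff hδ, dist_pi_lt_iff hδ]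
    refine ⟨fun i => (dist_pi_lt_iff hδ).2 fun j => hA i j, fun i => ?_⟩
    simpa using hv i
  obtain ⟨h1, h2⟩ := hball hd
  refine ⟨_, ?_, h1⟩
  change (Matrix.of A).mulVec ((Matrix.of A).det⁻¹ • (Matrix.of A).adjugate.mulVec v) = v
  rw [Matrix.mulVec_smul, Matrix.mulVec_mulVec, Matrix.mul_adjugate, Matrix.smul_mulVec, smul_smul,
    inv_mul_cancel₀ h2, one_smul, Matrix.one_mulVec]

variable {Ω : Type*} [TopologicalSpace Ω] [CompactSpace Ω] [MeasurableSpace Ω] [BorelSpace Ω]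

theorem integrable_continuousMap (f : C(Ω, ℝ)) (E : Measure Ω) [IsFiniteMeasure E] :
    Integrable f E :=
  f.continuous.integrable_of_hasCompactSupport (HasCompactSupport.of_compactSpace f)

theorem integrable_continuousMap_mul (f g : C(Ω, ℝ)) (E : Measure Ω) [IsFiniteMeasure E] :
    Integrable (fun ω => f ω * g ω) E :=
  integrable_continuousMap (f * g) E

/-- The measure `ν = (1 - ε) Q + (ε + h) E`. The condition on `h` says that `h E` compensates, on `W`,
for the difference between `E` and `Q`; as `1 ∈ W`, it also makes `ν` a probability measure. -/
theorem exists_measure_of_density (W : Submodule ℝ C(Ω, ℝ)) (hW : (1 : C(Ω, ℝ)) ∈ W)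
    (E Q : Measure Ω) [IsProbabilityMeasure E] [IsProbabilityMeasure Q] {ε : ℝ} (hε : ε ≤ 1)
    (h : C(Ω, ℝ)) (hh : ‖h‖ ≤ ε)
    (hmom : ∀ g ∈ W, ∫ ω, h ω * g ω ∂E = (1 - ε) * (∫ ω, g ω ∂E - ∫ ω, g ω ∂Q)) :
    ∃ ν : Measure Ω, IsProbabilityMeasure ν ∧ (∀ g ∈ W, ∫ ω, g ω ∂ν = ∫ ω, g ω ∂E) ∧
      ν ≪ Q + E ∧ ∀ F : C(Ω, ℝ), ∀ C : ℝ, (∀ ω ω', |F ω - F ω'| ≤ C) →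
        |∫ ω, F ω ∂Q - ∫ ω, F ω ∂ν| ≤ 3 * ε * C := by
  have hbd : ∀ ω, |h ω| ≤ ε := fun ω => (h.norm_coe_le_norm ω).trans hh
  have hε0 : 0 ≤ ε := (norm_nonneg h).trans hh
  have hpos : ∀ ω, 0 ≤ ε + h ω := fun ω => by linarith [neg_abs_le (h ω), hbd ω]
  have hdens : Measurable fun ω => ENNReal.ofReal (ε + h ω) :=
    (measurable_const.add h.continuous.measurable).ennreal_ofReal
  set D : Measure Ω := E.withDensity fun ω => ENNReal.ofReal (ε + h ω) with hD
  have hDint : ∀ G : C(Ω, ℝ), ∫ ω, G ω ∂D = ε * ∫ ω, G ω ∂E + ∫ ω, h ω * G ω ∂E := by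
    intro G
    rw [hD, integral_withDensity_eq_integral_toReal_smul hdens (by simp), ← integral_const_mul,
      ← integral_add ((integrable_continuousMap G E).const_mul ε)
        (integrable_continuousMap_mul h G E)]
    refine integral_congr_ae (.of_forall fun ω => ?_)
    simp only [ENNReal.toReal_ofReal (hpos ω), smul_eq_mul]
    ring
  have hDfin : IsFiniteMeasure D :=
    isFiniteMeasure_withDensity_ofReal
      (integrable_continuousMap (ContinuousMap.const Ω ε + h) E).hasFiniteIntegral
  set ν : Measure Ω := ENNReal.ofReal (1 - ε) • Q + D with hR
  have hQfin : IsFiniteMeasure (ENNReal.ofReal (1 - ε) • Q) :=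
    Q.smul_finite ENNReal.ofReal_ne_top
  have hRint : ∀ G : C(Ω, ℝ), ∫ ω, G ω ∂ν =
      (1 - ε) * ∫ ω, G ω ∂Q + (ε * ∫ ω, G ω ∂E + ∫ ω, h ω * G ω ∂E) := by
    intro G
    rw [hR, integral_add_measure (integrable_continuousMap G _) (integrable_continuousMap G _),
      integral_smul_measure, hDint, ENNReal.toReal_ofReal (by linarith), smul_eq_mul]
  have hRmom : ∀ g ∈ W, ∫ ω, g ω ∂ν = ∫ ω, g ω ∂E := by
    intro g hg
    rw [hRint, hmom g hg]
    ring
  have hRprob : IsProbabilityMeasure ν := by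
    have h1 := hRmom 1 hW
    simp only [ContinuousMap.one_apply, integral_const, smul_eq_mul, mul_one, measureReal_def,
      measure_univ, ENNReal.toReal_one] at h1
    exact ⟨(ENNReal.toReal_eq_one_iff _).1 h1⟩
  refine ⟨ν, hRprob, hRmom, ?_, fun F C hF => ?_⟩
  · exact Measure.AbsolutelyContinuous.add_left
      ((Measure.smul_absolutelyContinuous).trans
        (Measure.AbsolutelyContinuous.rfl.add_right E))
      ((withDensity_absolutelyContinuous _ _).trans
        (by rw [add_comm]; exact Measure.AbsolutelyContinuous.rfl.add_right Q))
  · obtain ⟨ω₀⟩ : Nonempty Ω := nonempty_of_isProbabilityMeasure E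
    -- Both measures have mass one, so `F` may be replaced by `F - F ω₀`, which is bounded by `C`.
    set G : C(Ω, ℝ) := F - ContinuousMap.const Ω (F ω₀) with hG
    have hGF : ∀ (P : Measure Ω) [IsProbabilityMeasure P],
        ∫ ω, G ω ∂P = ∫ ω, F ω ∂P - F ω₀ := by
      intro P _
      simp only [hG, ContinuousMap.sub_apply, ContinuousMap.const_apply]
      rw [integral_sub (integrable_continuousMap F P) (integrable_const _)]
      simp
    have hGC : ∀ ω, |G ω| ≤ C := fun ω => hF ω ω₀
    have hC : 0 ≤ C := (abs_nonneg _).trans (hGC ω₀)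
    have hbound : ∀ (P : Measure Ω) [IsProbabilityMeasure P] (g : Ω → ℝ) (c : ℝ),
        (∀ ω, |g ω| ≤ c) → |∫ ω, g ω ∂P| ≤ c := by
      intro P _ g c hg
      simpa using norm_integral_le_of_norm_le_const (μ := P) (f := g) (C := c) (.of_forall hg)
    have e1 := hbound Q G C hGC
    have e2 := hbound E G C hGC
    have e3 := hbound E (fun ω => h ω * G ω) (ε * C) fun ω => by
      rw [abs_mul]
      exact mul_le_mul (hbd ω) (hGC ω) (abs_nonneg _) hε0
    have e4 : ∫ ω, F ω ∂Q - ∫ ω, F ω ∂ν =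
        ε * ∫ ω, G ω ∂Q - ε * ∫ ω, G ω ∂E - ∫ ω, h ω * G ω ∂E := by
      have := hRint G
      have h1 := hGF Q
      have h2 := hGF ν
      linarith
    rw [e4]
    have a1 : |ε * ∫ ω, G ω ∂Q| ≤ ε * C := by
      rw [abs_mul, abs_of_nonneg hε0]; gcongr
    have a2 : |ε * ∫ ω, G ω ∂E| ≤ ε * C := by
      rw [abs_mul, abs_of_nonneg hε0]; gcongr
    rw [abs_le] at *
    constructor <;> linarith [a1.1, a1.2, a2.1, a2.2, e3.1, e3.2]

/-- The Gram matrix of `f` in `L²(E)`. -/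
def gramMatrix {ι : Type*} (f : ι → C(Ω, ℝ)) (E : Measure Ω) : Matrix ι ι ℝ :=
  Matrix.of fun i j => ∫ ω, f i ω * f j ω ∂E

theorem gramMatrix_mulVec {ι : Type*} [Fintype ι] (f : ι → C(Ω, ℝ)) (E : Measure Ω)
    [IsFiniteMeasure E] (a : ι → ℝ) (i : ι) :
    (gramMatrix f E).mulVec a i = ∫ ω, (∑ j, a j • f j) ω * f i ω ∂E := by
  simp only [ContinuousMap.coe_sum, ContinuousMap.coe_smul, Finset.sum_apply, Pi.smul_apply,
    smul_eq_mul, Finset.sum_mul, Matrix.mulVec, dotProduct, gramMatrix, Matrix.of_apply]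
  refine Eq.trans ?_ (integral_finsetSum _ fun j _ =>
    integrable_continuousMap_mul (a j • f j) (f i) E).symm
  refine Finset.sum_congr rfl fun j _ => ?_
  rw [mul_comm, ← integral_const_mul]
  refine integral_congr_ae (.of_forall fun ω => ?_)
  simp only [ContinuousMap.coe_smul, Pi.smul_apply, smul_eq_mul]
  ring

/-- If `∑ a j • f j` has norm zero in `L²(P)`, then it vanishes identically, because it is continuous
and `P` has full support. -/
theorem isUnit_det_gramMatrix {ι : Type*} [Fintype ι] [DecidableEq ι] (f : ι → C(Ω, ℝ))
    (hf : LinearIndependent ℝ f) (P : Measure Ω) [IsFiniteMeasure P] [P.IsOpenPosMeasure] :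
    IsUnit (gramMatrix f P).det := by
  rw [isUnit_iff_ne_zero, Ne, ← Matrix.exists_mulVec_eq_zero_iff]
  rintro ⟨a, ha, h0⟩
  refine ha ?_
  set g : C(Ω, ℝ) := ∑ j, a j • f j with hg
  have hint : ∫ ω, g ω * g ω ∂P = 0 := by
    have : ∀ i, ∫ ω, g ω * f i ω ∂P = 0 := fun i => by
      rw [← gramMatrix_mulVec f P a i, h0, Pi.zero_apply]
    have e : ∀ ω, g ω * g ω = ∑ i, a i * (g ω * f i ω) := fun ω => by
      conv_lhs => rw [hg]
      simp only [ContinuousMap.coe_sum, ContinuousMap.coe_smul, Finset.sum_apply, Pi.smul_apply,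
        smul_eq_mul, Finset.mul_sum]
      exact Finset.sum_congr rfl fun j _ => by simp [hg]; ring
    simp only [e]
    rw [integral_finsetSum _ fun i _ => (integrable_continuousMap_mul g (f i) P).const_mul (a i)]
    simp [integral_const_mul, this]
  rw [integral_eq_zero_iff_of_nonneg (fun ω => mul_self_nonneg (g ω))
    (integrable_continuousMap_mul g g P)] at hint
  have hgg : (fun ω => g ω * g ω) = 0 :=
    ((g.continuous.mul g.continuous).ae_eq_iff_eq P continuous_zero).1 hint
  have hg0 : ∑ j, a j • f j = 0 := by
    ext ω
    simpa [hg] using mul_self_eq_zero.1 (congrFun hgg ω)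
  exact funext fun i => Fintype.linearIndependent_iff.1 hf a hg0 i

/-- A probability measure `Q` whose moments are close to those of `E` can be moved to a nearby `ν` that
has exactly the moments of `E`, provided that `E` is weakly close to a measure `P` of full support.
The finite sets `T` and `T'` hold the test functions for which closeness is needed: the products of
the elements of a basis of `W`, whose integrals form the Gram matrix, and the basis itself. Neither
they nor `δ` depend on `E` and `Q`, which makes the approximation uniform in `Q`. -/
theorem exists_measure_moments_eq (W : Submodule ℝ C(Ω, ℝ)) [FiniteDimensional ℝ W]
    (hW : (1 : C(Ω, ℝ)) ∈ W) (P : Measure Ω) [IsProbabilityMeasure P] [P.IsOpenPosMeasure]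
    {ε : ℝ} (hε : 0 < ε) (hε1 : ε ≤ 1) :
    ∃ (T T' : Finset C(Ω, ℝ)) (δ : ℝ), (∀ g ∈ T', g ∈ W) ∧ 0 < δ ∧
      ∀ (E Q : Measure Ω) [IsProbabilityMeasure E] [IsProbabilityMeasure Q],
        (∀ g ∈ T, |∫ ω, g ω ∂E - ∫ ω, g ω ∂P| < δ) →
        (∀ g ∈ T', |∫ ω, g ω ∂E - ∫ ω, g ω ∂Q| < δ) →
        ∃ ν : Measure Ω, IsProbabilityMeasure ν ∧ (∀ g ∈ W, ∫ ω, g ω ∂ν = ∫ ω, g ω ∂E) ∧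
          ν ≪ Q + E ∧ ∀ F : C(Ω, ℝ), ∀ C : ℝ, (∀ ω ω', |F ω - F ω'| ≤ C) →
            |∫ ω, F ω ∂Q - ∫ ω, F ω ∂ν| ≤ 3 * ε * C := by
  classical
  let b := Module.finBasis ℝ W
  let f : Fin (Module.finrank ℝ W) → C(Ω, ℝ) := fun i => b i
  have hf : LinearIndependent ℝ f := b.linearIndependent.map' W.subtype (Submodule.ker_subtype W)
  obtain ⟨δ, hδ, key⟩ := exists_mulVec_eq_and_norm_lt f (fun i j => ∫ ω, f i ω * f j ω ∂P)
    (isUnit_det_gramMatrix f hf P) hε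
  refine ⟨Finset.univ.image fun p : Fin _ × Fin _ => f p.1 * f p.2, Finset.univ.image f, δ, ?_,
    hδ, fun E Q _ _ hE hQ => ?_⟩
  · simp only [Finset.mem_image, Finset.mem_univ, true_and, forall_exists_index,
      forall_apply_eq_imp_iff]
    exact fun i => (b i).2
  · obtain ⟨a, ha, hsmall⟩ := key (fun i j => ∫ ω, f i ω * f j ω ∂E)
      (fun i => (1 - ε) * (∫ ω, f i ω ∂E - ∫ ω, f i ω ∂Q))
      (fun i j => hE (f i * f j) (Finset.mem_image.2 ⟨(i, j), Finset.mem_univ _, rfl⟩))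
      (fun i => by
        have h1 := hQ (f i) (Finset.mem_image.2 ⟨i, Finset.mem_univ _, rfl⟩)
        rw [abs_mul, abs_of_nonneg (by linarith)]
        exact (mul_le_of_le_one_left (abs_nonneg _) (by linarith)).trans_lt h1)
    refine exists_measure_of_density W hW E Q hε1 _ hsmall.le fun g hg => ?_
    have hmom : ∀ i, ∫ ω, (∑ j, a j • f j) ω * f i ω ∂E =
        (1 - ε) * (∫ ω, f i ω ∂E - ∫ ω, f i ω ∂Q) := fun i => by
      rw [← gramMatrix_mulVec f E a i]
      exact congrFun ha i
    -- Both sides are linear in `g`, so it is enough to know the identity on the basis.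
    set h : C(Ω, ℝ) := ∑ j, a j • f j
    have hgsum : g = ∑ i, b.repr ⟨g, hg⟩ i • f i := by
      have := congrArg (Subtype.val : W → C(Ω, ℝ)) (b.sum_repr ⟨g, hg⟩)
      rw [Submodule.coe_sum] at this
      exact this.symm
    generalize (b.repr ⟨g, hg⟩ : Fin _ → ℝ) = c at hgsum
    have lin : ∀ (u : C(Ω, ℝ)) (M : Measure Ω) [IsProbabilityMeasure M],
        ∫ ω, u ω * g ω ∂M = ∑ i, c i * ∫ ω, u ω * f i ω ∂M := by
      intro u M _
      simp only [← integral_const_mul]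
      rw [← integral_finsetSum _ fun i _ => (integrable_continuousMap_mul u (f i) M).const_mul (c i)]
      refine integral_congr_ae (.of_forall fun ω => ?_)
      simp only [hgsum, ContinuousMap.coe_sum, ContinuousMap.coe_smul, Finset.sum_apply,
        Pi.smul_apply, smul_eq_mul, Finset.mul_sum]
      exact Finset.sum_congr rfl fun i _ => by ring
    have linE := lin 1 E
    have linQ := lin 1 Q
    simp only [ContinuousMap.one_apply, one_mul] at linE linQ
    rw [lin h E, linE, linQ, ← Finset.sum_sub_distrib, Finset.mul_sum]
    exact Finset.sum_congr rfl fun i _ => by rw [hmom i]; ring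

end Adjust

/-! ### The update map, discrete and empirical measures -/

section Discrete

variable {Ω : Type*}

/-- The approximate set for the empty sample is empty, since an empty sum is not one. -/
theorem pos_of_mem_approxMomentSet {q : ℕ} {ψ : Fin q → Ω → ℝ} {x : ℕ → Ω} {k : ℕ}
    {p : sampleSet x k → ℝ} (hp : p ∈ approxMomentSet ψ x k) : 0 < k := by
  refine Nat.pos_of_ne_zero fun hk => ?_
  subst hk
  have : IsEmpty (sampleSet x 0) := ⟨fun ω => by simpa [sampleSet] using ω.2⟩
  have h1 := hp.2.1
  rw [Fintype.sum_empty] at h1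
  exact zero_ne_one h1

/-- The updated vector is the mixture of the old vector and the unit mass at the new observation,
whether or not the new observation has occurred before. -/
theorem sum_updateMap_mul (x : ℕ → Ω) (k : ℕ) (θ : ℝ) (p : sampleSet x k → ℝ) (g : Ω → ℝ) :
    ∑ ω, updateMap x k θ p ω * g ω = θ * ∑ ω, p ω * g ω + (1 - θ) * g (x k) := by
  classical
  have hsub : sampleSet x k ⊆ sampleSet x (k + 1) :=
    Finset.image_subset_image (Finset.range_mono k.le_succ)
  have hmem : x k ∈ sampleSet x (k + 1) :=
    Finset.mem_image_of_mem x (Finset.self_mem_range_succ k)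
  -- Both vectors are regarded as functions on `Ω`, extended by zero.
  set P : Ω → ℝ := fun ω => if h : ω ∈ sampleSet x k then p ⟨ω, h⟩ else 0 with hP
  have hup : ∀ ω : sampleSet x (k + 1), updateMap x k θ p ω * g ω =
      θ * (P ω * g ω) + if (ω : Ω) = x k then (1 - θ) * g ω else 0 := by
    rintro ⟨ω, hω⟩
    by_cases h : ω ∈ sampleSet x k
    · by_cases h' : ω = x k
      · simp only [updateMap, hP, h, dif_pos, if_pos h']
        ring
      · simp only [updateMap, hP, h, dif_pos, if_neg h']
        ring
    · have h' : ω = x k := by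
        obtain ⟨j, hj, rfl⟩ := Finset.mem_image.1 hω
        rcases Finset.mem_range_succ_iff.1 hj |>.eq_or_lt with rfl | hlt
        · rfl
        · exact absurd (Finset.mem_image_of_mem x (Finset.mem_range.2 hlt)) h
      simp only [updateMap, hP, dif_neg h, if_pos h']
      ring
  rw [Finset.sum_congr rfl fun ω _ => hup ω, Finset.sum_add_distrib, ← Finset.mul_sum]
  congr 1
  · congr 1
    rw [Finset.sum_coe_sort (sampleSet x (k + 1)) fun ω => P ω * g ω,
      ← Finset.sum_subset hsub fun ω _ h => by simp [hP, h],
      ← Finset.sum_coe_sort (sampleSet x k) fun ω => P ω * g ω]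
    exact Finset.sum_congr rfl fun ω _ => by simp [hP]
  · rw [Finset.sum_coe_sort (sampleSet x (k + 1)) fun ω => if ω = x k then (1 - θ) * g ω else 0,
      Finset.sum_ite_eq' _ _ fun ω => (1 - θ) * g ω, if_pos hmem]

theorem updateMap_mem_approxMomentSet {q : ℕ} {ψ : Fin q → Ω → ℝ} {x : ℕ → Ω} {k : ℕ}
    {p : sampleSet x k → ℝ} (hp : p ∈ approxMomentSet ψ x k) :
    updateMap x k ((k : ℝ) / ((k : ℝ) + 1)) p ∈ approxMomentSet ψ x (k + 1) := by
  have hk : (0 : ℝ) < k := Nat.cast_pos.2 (pos_of_mem_approxMomentSet hp)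
  obtain ⟨h0, h1, hm⟩ := hp
  have hθ : 0 ≤ (k : ℝ) / (k + 1) := by positivity
  have hθ1 : (1 : ℝ) - k / (k + 1) = 1 / (k + 1) := by field_simp; ring
  have hθ2 : 0 ≤ (1 : ℝ) - k / (k + 1) := by rw [hθ1]; positivity
  refine ⟨fun ω => ?_, ?_, fun i => ?_⟩
  · unfold updateMap
    split_ifs
    · exact add_nonneg (mul_nonneg hθ (h0 _)) hθ2
    · exact mul_nonneg hθ (h0 _)
    · exact hθ2
  · have h := sum_updateMap_mul x k (k / (k + 1)) p fun _ => 1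
    simp only [mul_one] at h
    rw [h, h1]
    ring
  · rw [sum_updateMap_mul x k _ p (ψ i), hm i, hθ1, sampleMoment, sampleMoment,
      Finset.sum_range_succ]
    push_cast
    field_simp

variable [MeasurableSpace Ω]

/-- The empirical measure of the first `k` observations; the zero measure for `k = 0`. -/
def empiricalMeasure (x : ℕ → Ω) (k : ℕ) : Measure Ω :=
  (k : ℝ≥0∞)⁻¹ • ∑ j ∈ Finset.range k, Measure.dirac (x j)

theorem isProbabilityMeasure_discreteMeasure {A : Finset Ω} {p : A → ℝ} (hp : ∀ ω, 0 ≤ p ω)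
    (hsum : ∑ ω, p ω = 1) : IsProbabilityMeasure (discreteMeasure p) := by
  constructor
  simp only [discreteMeasure, Measure.finsetSum_apply, Measure.smul_apply, measure_univ,
    smul_eq_mul, mul_one]
  rw [← ENNReal.ofReal_sum_of_nonneg fun ω _ => hp ω, hsum, ENNReal.ofReal_one]

theorem isProbabilityMeasure_empiricalMeasure (x : ℕ → Ω) {k : ℕ} (hk : 0 < k) :
    IsProbabilityMeasure (empiricalMeasure x k) := by
  constructor
  simp [empiricalMeasure, ENNReal.inv_mul_cancel, hk.ne']

variable [MeasurableSingletonClass Ω]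

theorem integral_discreteMeasure {A : Finset Ω} {p : A → ℝ} (hp : ∀ ω, 0 ≤ p ω) (F : Ω → ℝ) :
    ∫ ω, F ω ∂discreteMeasure p = ∑ ω, p ω * F ω := by
  unfold discreteMeasure
  rw [integral_finsetSum_measure fun ω _ =>
    (integrable_dirac (by simp)).smul_measure ENNReal.ofReal_ne_top]
  refine Finset.sum_congr rfl fun ω _ => ?_
  rw [integral_smul_measure, integral_dirac, ENNReal.toReal_ofReal (hp ω), smul_eq_mul]

theorem eq_discreteMeasure_of_compl_eq_zero {A : Finset Ω} {ν : Measure Ω} [IsFiniteMeasure ν]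
    (hA : ν (A : Set Ω)ᶜ = 0) : discreteMeasure (fun ω : A => ν.real {(ω : Ω)}) = ν := by
  classical
  ext s hs
  have h1 : ν s = ν ((A.filter (· ∈ s) : Finset Ω) : Set Ω) := by
    rw [Finset.coe_filter]
    refine (measure_inter_conull (t := (A : Set Ω)) ?_).symm.trans ?_
    · exact hA
    · congr 1
      ext ω
      simp [and_comm]
  rw [h1, ← sum_measure_singleton, Finset.sum_filter, discreteMeasure, Measure.finsetSum_apply,
    ← Finset.sum_coe_sort A]
  refine Finset.sum_congr rfl fun ω _ => ?_
  simp [hs, Set.indicator_apply]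

/-- Every probability measure that is carried by the sample and has the sample moments is the discrete
measure of a vector in the approximate moment ambiguity set. -/
theorem mem_image_discreteMeasure {q : ℕ} {ψ : Fin q → Ω → ℝ} {x : ℕ → Ω} {k : ℕ}
    {ν : Measure Ω} [IsProbabilityMeasure ν] (hA : ν (sampleSet x k : Set Ω)ᶜ = 0)
    (hmom : ∀ i, ∫ ω, ψ i ω ∂ν = sampleMoment ψ x k i) :
    ν ∈ discreteMeasure '' approxMomentSet ψ x k := by
  have hν := eq_discreteMeasure_of_compl_eq_zero hA
  have hp : ∀ ω : sampleSet x k, 0 ≤ ν.real {(ω : Ω)} := fun _ => measureReal_nonneg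
  refine ⟨_, ⟨hp, ?_, fun i => ?_⟩, hν⟩
  · have := integral_discreteMeasure hp fun _ => 1
    rw [hν] at this
    simpa using this.symm
  · rw [← hmom i, ← integral_discreteMeasure hp, hν]

theorem integral_empiricalMeasure (x : ℕ → Ω) (k : ℕ) (F : Ω → ℝ) :
    ∫ ω, F ω ∂empiricalMeasure x k = (1 / (k : ℝ)) * ∑ j ∈ Finset.range k, F (x j) := by
  unfold empiricalMeasure
  rw [integral_smul_measure, integral_finsetSum_measure fun ω _ => integrable_dirac (by simp)]
  simp

theorem empiricalMeasure_compl_sampleSet (x : ℕ → Ω) (k : ℕ) :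
    empiricalMeasure x k (sampleSet x k : Set Ω)ᶜ = 0 := by
  rw [empiricalMeasure, Measure.smul_apply, Measure.finsetSum_apply,
    Finset.sum_eq_zero, smul_zero]
  intro j hj
  rw [Measure.dirac_apply' _ (Finset.measurableSet _).compl, Set.indicator_of_notMem]
  simpa [sampleSet] using ⟨j, Finset.mem_range.1 hj, rfl⟩

end Discrete

/-! ### Samples that equidistribute -/

section Sample

/-- Nearest-point projection onto an `η`-net. -/
theorem exists_measurable_dist_lt {Ω : Type*} [MetricSpace Ω] [MeasurableSpace Ω]
    [OpensMeasurableSpace Ω] {x : ℕ → Ω} {k : ℕ} (hk : 0 < k) {η : ℝ}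
    (hnet : ∀ ω, ∃ j < k, dist (x j) ω < η) :
    ∃ T : Ω → Ω, Measurable T ∧ (∀ ω, T ω ∈ sampleSet x k) ∧ ∀ ω, dist (T ω) ω < η := by
  classical
  refine ⟨SimpleFunc.nearestPt x (k - 1), SimpleFunc.measurable _, fun ω => ?_, fun ω => ?_⟩
  · refine Finset.mem_image.2 ⟨SimpleFunc.nearestPtInd x (k - 1) ω, ?_, rfl⟩
    have := SimpleFunc.nearestPtInd_le x (k - 1) ω
    exact Finset.mem_range.2 (by omega)
  · obtain ⟨j, hj, hd⟩ := hnet ω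
    have := SimpleFunc.edist_nearestPt_le x ω (k := j) (N := k - 1) (by omega)
    rw [edist_dist, edist_dist, ENNReal.ofReal_le_ofReal_iff dist_nonneg] at this
    exact this.trans_lt hd

variable {Ω : Type*} [MetricSpace Ω] [CompactSpace Ω] [MeasurableSpace Ω] [BorelSpace Ω]

/-- The strong law of large numbers, simultaneously for all continuous functions, since `C(Ω, ℝ)`
is separable. -/
theorem ae_tendsto_integral_empiricalMeasure (P : Measure Ω) [IsProbabilityMeasure P]
    {S : Type*} [MeasurableSpace S] (μ : Measure S) [IsProbabilityMeasure μ]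
    (X : ℕ → S → Ω) (hlaw : ∀ j, HasLaw (X j) P μ) (hindep : iIndepFun X μ) :
    ∀ᵐ s ∂μ, ∀ f : C(Ω, ℝ), Tendsto
      (fun k => ∫ ω, f ω ∂empiricalMeasure (fun j => X j s) k) atTop (𝓝 (∫ ω, f ω ∂P)) := by
  have hone : ∀ f : C(Ω, ℝ), ∀ᵐ s ∂μ, Tendsto
      (fun k => ∫ ω, f ω ∂empiricalMeasure (fun j => X j s) k) atTop (𝓝 (∫ ω, f ω ∂P)) := by
    intro f
    have hmeas := f.continuous.measurable
    have hid : ∀ i, IdentDistrib (X i) (X 0) μ μ := fun i =>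
      ⟨(hlaw i).aemeasurable, (hlaw 0).aemeasurable, by rw [(hlaw i).map_eq, (hlaw 0).map_eq]⟩
    have hint : Integrable (fun s => f (X 0 s)) μ := by
      have := integrable_continuousMap f P
      rw [← (hlaw 0).map_eq] at this
      exact this.comp_aemeasurable (hlaw 0).aemeasurable
    have hlim := strong_law_ae_real (fun j s => f (X j s)) hint
      (fun i j hij => (hindep.indepFun hij).comp hmeas hmeas) fun i => (hid i).comp hmeas
    have hP : ∫ s, f (X 0 s) ∂μ = ∫ ω, f ω ∂P :=
      (hlaw 0).integral_comp hmeas.aestronglyMeasurable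
    filter_upwards [hlim] with s hs
    rw [hP] at hs
    refine hs.congr fun k => ?_
    rw [integral_empiricalMeasure]
    ring
  filter_upwards [ae_all_iff.2 fun n => hone (TopologicalSpace.denseSeq C(Ω, ℝ) n)] with s hs f
  rw [Metric.tendsto_atTop]
  intro ε hε
  obtain ⟨n, hn⟩ := (TopologicalSpace.denseRange_denseSeq C(Ω, ℝ)).exists_dist_lt f
    (by positivity : 0 < ε / 3)
  obtain ⟨N, hN⟩ := Metric.tendsto_atTop.1 (hs n) (ε / 3) (by positivity)
  set g := TopologicalSpace.denseSeq C(Ω, ℝ) n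
  have hclose : ∀ (E : Measure Ω) [IsProbabilityMeasure E],
      |∫ ω, f ω ∂E - ∫ ω, g ω ∂E| ≤ ε / 3 := by
    intro E _
    rw [← integral_sub (integrable_continuousMap f E) (integrable_continuousMap g E)]
    simpa using norm_integral_le_of_norm_le_const (μ := E) (f := fun ω => f ω - g ω) (C := ε / 3)
      (.of_forall fun ω => (ContinuousMap.dist_lt_iff (by positivity)).1 hn ω |>.le)
  refine ⟨max N 1, fun k hk => ?_⟩
  have := isProbabilityMeasure_empiricalMeasure (fun j => X j s) (le_trans (le_max_right N 1) hk)
  have h1 := hclose (empiricalMeasure (fun j => X j s) k)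
  have h2 := hclose P
  have h3 := hN k (le_trans (le_max_left N 1) hk)
  rw [Real.dist_eq, abs_lt] at *
  rw [abs_le] at h1 h2
  constructor <;> linarith [h1.1, h1.2, h2.1, h2.2, h3.1, h3.2]

/-- If the empirical measures converge to a measure of full support, then the sample becomes an
`η`-net. -/
theorem eventually_forall_exists_dist_lt (P : Measure Ω) [IsProbabilityMeasure P]
    [P.IsOpenPosMeasure] {x : ℕ → Ω}
    (hx : ∀ f : C(Ω, ℝ), Tendsto (fun k => ∫ ω, f ω ∂empiricalMeasure x k) atTop
      (𝓝 (∫ ω, f ω ∂P))) {η : ℝ} (hη : 0 < η) :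
    ∀ᶠ k in atTop, ∀ ω, ∃ j < k, dist (x j) ω < η := by
  have hdense : DenseRange x := by
    rw [Metric.denseRange_iff]
    intro ω₀ r hr
    by_contra! hfar
    -- The bump function vanishes on the sample, so its integral under `P` would be zero.
    let f : C(Ω, ℝ) := ⟨fun ω => max (r - dist ω₀ ω) 0, by fun_prop⟩
    have hzero : ∀ k, ∫ ω, f ω ∂empiricalMeasure x k = 0 := fun k => by
      rw [integral_empiricalMeasure, Finset.sum_eq_zero fun j _ => ?_, mul_zero]
      exact max_eq_right (by linarith [hfar j])
    have hlim : ∫ ω, f ω ∂P = 0 :=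
      tendsto_nhds_unique (hx f) (by simp only [hzero]; exact tendsto_const_nhds)
    have hf : 0 ≤ (f : Ω → ℝ) := fun ω => le_max_right _ _
    rw [integral_eq_zero_iff_of_nonneg hf (integrable_continuousMap f P)] at hlim
    have hf0 : (f : Ω → ℝ) = 0 := (f.continuous.ae_eq_iff_eq P continuous_zero).1 hlim
    have : max (r - dist ω₀ ω₀) 0 = 0 := congrFun hf0 ω₀
    rw [dist_self, sub_zero, max_eq_left hr.le] at this
    exact hr.ne' this
  obtain ⟨t, ht⟩ := isCompact_univ.elim_finite_subcover (fun j => Metric.ball (x j) η)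
    (fun _ => Metric.isOpen_ball) fun ω _ => by
      obtain ⟨j, hj⟩ := hdense.exists_dist_lt ω hη
      exact Set.mem_iUnion.2 ⟨j, hj⟩
  filter_upwards [eventually_gt_atTop (t.sup id)] with k hk ω
  obtain ⟨j, hjt, hj⟩ := Set.mem_iUnion₂.1 (ht (Set.mem_univ ω))
  exact ⟨j, (Finset.le_sup (f := id) hjt).trans_lt hk, by rwa [dist_comm]⟩

theorem abs_integral_sub_integral_map_le (P : Measure Ω) [IsProbabilityMeasure P] {T : Ω → Ω}
    (hT : Measurable T) (F : C(Ω, ℝ)) {c : ℝ} (hc : ∀ ω, |F ω - F (T ω)| ≤ c) :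
    |∫ ω, F ω ∂P - ∫ ω, F ω ∂(P.map T)| ≤ c := by
  have := Measure.isProbabilityMeasure_map (μ := P) hT.aemeasurable
  have hint : Integrable (fun ω => F (T ω)) P :=
    (integrable_continuousMap F (P.map T)).comp_measurable hT
  rw [integral_map hT.aemeasurable F.continuous.aestronglyMeasurable,
    ← integral_sub (integrable_continuousMap F P) hint]
  simpa using norm_integral_le_of_norm_le_const (μ := P) (f := fun ω => F ω - F (T ω)) (C := c)
    (.of_forall hc)

end Sample

/-! ### Convergence of the ambiguity sets -/

section Convergence

theorem deviation_le {Ω : Type*} [MeasurableSpace Ω] {𝓕 : Set (Ω → ℝ)} {A B : Set (Measure Ω)}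
    {c : ℝ≥0∞} (h : ∀ P ∈ B, ∃ P' ∈ A, ∀ F ∈ 𝓕,
      ENNReal.ofReal |∫ ω, F ω ∂P - ∫ ω, F ω ∂P'| ≤ c) :
    deviation 𝓕 A B ≤ c := by
  refine iSup₂_le fun P hP => ?_
  obtain ⟨P', hP', hle⟩ := h P hP
  exact (iInf₂_le P' hP').trans (iSup₂_le hle)

variable {Ω : Type*} [MetricSpace Ω] [CompactSpace Ω] [MeasurableSpace Ω] [BorelSpace Ω]

/-- The space of continuous functions spanned by the moment functions and the constants. -/
def momentSpan {q : ℕ} (ψ : Fin q → C(Ω, ℝ)) : Submodule ℝ C(Ω, ℝ) :=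
  Submodule.span ℝ (insert 1 (Set.range ψ))

instance {q : ℕ} (ψ : Fin q → C(Ω, ℝ)) : FiniteDimensional ℝ (momentSpan ψ) :=
  FiniteDimensional.span_of_finite ℝ ((Set.finite_range ψ).insert 1)

theorem integral_eq_of_mem_momentSpan {q : ℕ} {ψ : Fin q → C(Ω, ℝ)} {P Q : Measure Ω}
    [IsProbabilityMeasure P] [IsProbabilityMeasure Q]
    (h : ∀ i, ∫ ω, ψ i ω ∂P = ∫ ω, ψ i ω ∂Q) {g : C(Ω, ℝ)} (hg : g ∈ momentSpan ψ) :
    ∫ ω, g ω ∂P = ∫ ω, g ω ∂Q := by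
  induction hg using Submodule.span_induction with
  | mem g hg =>
    rcases hg with rfl | ⟨i, rfl⟩
    · simp
    · exact h i
  | zero => simp
  | add f g _ _ hf hg =>
    simp only [ContinuousMap.add_apply]
    rw [integral_add (integrable_continuousMap f P) (integrable_continuousMap g P),
      integral_add (integrable_continuousMap f Q) (integrable_continuousMap g Q), hf, hg]
  | smul a f _ hf =>
    simp only [ContinuousMap.smul_apply, integral_smul, hf]

/-- The convergence for one fixed sample along which the empirical measures converge weakly to `P`. -/
theorem tendsto_hausdorffDistance (P : Measure Ω) [IsProbabilityMeasure P] [P.IsOpenPosMeasure]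
    {q : ℕ} (ψ : Fin q → C(Ω, ℝ)) {x : ℕ → Ω}
    (hx : ∀ f : C(Ω, ℝ), Tendsto (fun k => ∫ ω, f ω ∂empiricalMeasure x k) atTop
      (𝓝 (∫ ω, f ω ∂P)))
    {𝓕 : Set (Ω → ℝ)} (hequi : 𝓕.Equicontinuous) {C : ℝ}
    (hC : ∀ F ∈ 𝓕, ∀ ω ω' : Ω, |F ω - F ω'| ≤ C) :
    Tendsto (fun k : ℕ => hausdorffDistance 𝓕
      (discreteMeasure '' approxMomentSet (fun i => ψ i) x k)
      (momentSet (fun i => ψ i) fun i => ∫ ω, ψ i ω ∂P)) atTop (𝓝 0) := by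
  rw [ENNReal.tendsto_nhds_zero]
  intro e he
  obtain ⟨r, hr0, hre⟩ := ENNReal.lt_iff_exists_nnreal_btwn.1 he
  have hr : (0 : ℝ) < r := by exact_mod_cast hr0
  have hle : ∀ t : ℝ, t ≤ r → ENNReal.ofReal t ≤ e := fun t ht =>
    ((ENNReal.ofReal_le_ofReal ht).trans_eq (ENNReal.ofReal_coe_nnreal)).trans hre.le
  -- `ε` is chosen such that the bound `3 * ε * K` on the effect of an adjustment is at most `r / 2`.
  set K : ℝ := |C| + 1 with hK
  have hKpos : 0 < K := by positivity
  have hKC : ∀ F ∈ 𝓕, ∀ ω ω' : Ω, |F ω - F ω'| ≤ K := fun F hF ω ω' =>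
    (hC F hF ω ω').trans (by linarith [le_abs_self C])
  set ε : ℝ := min 1 (r / (6 * K)) with hε
  have hεpos : 0 < ε := by positivity
  have hεK : 3 * ε * K ≤ r / 2 := by
    have : ε * (6 * K) ≤ r := (le_div_iff₀ (by positivity)).1 (min_le_right _ _)
    linarith
  have hcont : ∀ F ∈ 𝓕, Continuous F := fun F hF => hequi.continuous ⟨F, hF⟩
  set W := momentSpan ψ
  obtain ⟨T, T', δ, hT'W, hδ, hadj⟩ := exists_measure_moments_eq W
    (Submodule.subset_span (Set.mem_insert _ _)) P hεpos (min_le_left _ _)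
  obtain ⟨η₁, hη₁, hF⟩ := Metric.uniformEquicontinuous_iff.1
    (CompactSpace.uniformEquicontinuous_of_equicontinuous hequi) (r / 2) (by positivity)
  obtain ⟨η₂, hη₂, hg⟩ := Metric.uniformEquicontinuous_iff.1
    (uniformEquicontinuous_finite.2 fun g : T' =>
      CompactSpace.uniformContinuous_of_continuous g.1.continuous) (δ / 2) (by positivity)
  have hev : ∀ (T : Finset C(Ω, ℝ)) {d : ℝ}, 0 < d → ∀ᶠ k in atTop,
      ∀ g ∈ T, |∫ ω, g ω ∂empiricalMeasure x k - ∫ ω, g ω ∂P| < d := by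
    intro T d hd
    rw [eventually_all_finset]
    intro g _
    exact (Metric.tendsto_nhds.1 (hx g)) d hd
  filter_upwards [hev T hδ, hev T' (half_pos hδ), eventually_gt_atTop 0,
    eventually_forall_exists_dist_lt P hx (lt_min hη₁ hη₂)] with k hk1 hk2 hk hnet
  have hEprob := isProbabilityMeasure_empiricalMeasure x hk
  have hEmom : ∀ i, ∫ ω, ψ i ω ∂empiricalMeasure x k = sampleMoment (fun i => ψ i) x k i :=
    fun i => integral_empiricalMeasure x k (ψ i)
  have hψW : ∀ i, ψ i ∈ W := fun i => Submodule.subset_span (.inr ⟨i, rfl⟩)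
  refine max_le (deviation_le ?_) (deviation_le ?_)
  · -- A measure in the moment set is discretized, and its moments are adjusted by a density with
    -- respect to the empirical measure.
    rintro P' ⟨hP', hmom⟩
    obtain ⟨τ, hτ, hτmem, hτd⟩ := exists_measurable_dist_lt hk hnet
    have := Measure.isProbabilityMeasure_map (μ := P') hτ.aemeasurable
    obtain ⟨ν, hν, hνW, hac, hνF⟩ := hadj (empiricalMeasure x k) (P'.map τ) hk1 fun g hgT => by
      have h1 := hk2 g hgT
      have h2 := abs_integral_sub_integral_map_le P' hτ g (c := δ / 2) fun ω => by
        have := hg _ _ ((hτd ω).trans_le (min_le_right _ _)) ⟨g, hgT⟩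
        rw [dist_comm] at this
        exact this.le
      have h3 : ∫ ω, g ω ∂P' = ∫ ω, g ω ∂P :=
        integral_eq_of_mem_momentSpan (fun i => (hmom i).2) (hT'W g hgT)
      rw [abs_lt] at h1 ⊢
      rw [abs_le] at h2
      constructor <;> linarith [h1.1, h1.2, h2.1, h2.2]
    refine ⟨ν, mem_image_discreteMeasure (hac ?_) fun i => ?_, fun F hFmem => hle _ ?_⟩
    · rw [Measure.add_apply, empiricalMeasure_compl_sampleSet, add_zero,
        Measure.map_apply hτ (Finset.measurableSet _).compl]
      convert measure_empty (μ := P')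
      ext ω
      simp [hτmem ω]
    · rw [hνW _ (hψW i), hEmom]
    · have h1 := abs_integral_sub_integral_map_le P' hτ ⟨F, hcont F hFmem⟩ (c := r / 2)
        fun ω => by
          have := hF _ _ ((hτd ω).trans_le (min_le_left _ _)) ⟨F, hFmem⟩
          rw [dist_comm] at this
          exact this.le
      have h2 := hνF ⟨F, hcont F hFmem⟩ K (hKC F hFmem)
      exact (abs_sub_le _ _ _).trans ((add_le_add h1 (h2.trans hεK)).trans_eq (add_halves _))
  · -- The moments of a measure in the approximate set are adjusted by a density with respect
    -- to `P`.
    rintro _ ⟨p, ⟨hp0, hp1, hpm⟩, rfl⟩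
    have := isProbabilityMeasure_discreteMeasure hp0 hp1
    obtain ⟨ν, hν, hνW, -, hνF⟩ := hadj P (discreteMeasure p) (fun g _ => by simpa using hδ)
      fun g hgT => by
        have h3 : ∫ ω, g ω ∂discreteMeasure p = ∫ ω, g ω ∂empiricalMeasure x k :=
          integral_eq_of_mem_momentSpan
            (fun i => by rw [integral_discreteMeasure hp0, hEmom]; exact hpm i) (hT'W g hgT)
        rw [h3, abs_sub_comm]
        linarith [hk2 g hgT]
    refine ⟨ν, ⟨hν, fun i => ⟨integrable_continuousMap (ψ i) ν, hνW _ (hψW i)⟩⟩,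
      fun F hFmem => hle _ ?_⟩
    have h2 := hνF ⟨F, hcont F hFmem⟩ K (hKC F hFmem)
    exact h2.trans (hεK.trans (by linarith))

end Convergence

end MomentAmbiguity

end

theorem mainTheorem2
    {Ω : Type*} [MetricSpace Ω] [CompactSpace Ω] [MeasurableSpace Ω] [BorelSpace Ω]
    -- the true distribution, whose support is the whole sample space
    (Pstar : Measure Ω) [IsProbabilityMeasure Pstar] [Pstar.IsOpenPosMeasure]
    {q : ℕ} (ψ : Fin q → Ω → ℝ)
    -- independent observations with law `Pstar`
    {S : Type*} [MeasurableSpace S] (μ : Measure S) [IsProbabilityMeasure μ]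
    (X : ℕ → S → Ω) (hlaw : ∀ j, HasLaw (X j) Pstar μ) (hindep : iIndepFun X μ) :
    (∀ (x : ℕ → Ω) (k : ℕ), ∀ p ∈ MomentAmbiguity.approxMomentSet ψ x k,
      MomentAmbiguity.updateMap x k ((k : ℝ) / ((k : ℝ) + 1)) p
        ∈ MomentAmbiguity.approxMomentSet ψ x (k + 1)) ∧
    ((∀ i, Continuous (ψ i)) →
      ∀ 𝓕 : Set (Ω → ℝ), 𝓕.Equicontinuous →
        (∃ C : ℝ, ∀ F ∈ 𝓕, ∀ ω ω' : Ω, |F ω - F ω'| ≤ C) →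
        ∀ᵐ s ∂μ,
          (∀ k ≥ 1, (MomentAmbiguity.approxMomentSet ψ (fun j => X j s) k).Nonempty) →
          Tendsto
            (fun k : ℕ => MomentAmbiguity.hausdorffDistance 𝓕
              (MomentAmbiguity.discreteMeasure ''
                MomentAmbiguity.approxMomentSet ψ (fun j => X j s) k)
              (MomentAmbiguity.momentSet ψ (fun i => ∫ ω, ψ i ω ∂Pstar)))
            atTop (𝓝 0)) := by
  refine ⟨fun x k p hp => MomentAmbiguity.updateMap_mem_approxMomentSet hp,
    fun hψ 𝓕 h𝓕 ⟨C, hC⟩ => ?_⟩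
  filter_upwards [MomentAmbiguity.ae_tendsto_integral_empiricalMeasure Pstar μ X hlaw hindep]
    with s hs _
  exact MomentAmbiguity.tendsto_hausdorffDistance Pstar (fun i => ⟨ψ i, hψ i⟩) hs h𝓕 hC
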